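/- Conventions. All Banach spaces are real. For a compact Hausdorff space $K$ and a Banach space $E$, $\mathcal C(K,E)$ is the Banach space of continuous functions $K\to E$ with the sup-norm, and $\mathcal C(K)=\mathcal C(K,\mathbb R)$. For a topological space $S$ put $S^{(0)}=S$, let $S^{(\alpha+1)}$ be the set of accumulation points of $S^{(\alpha)}$ in the space $S^{(\alpha)}$, and let $S^{(\alpha)}=\bigcap_{\beta<\alpha}S^{(\beta)}$ for limit ordinals $\alpha$. The space $S$ is scattered if $S^{(\alpha)}=\emptyset$ for some ordinal $\alpha$, and the least such $\alpha$ is its height $ht(S)$. Subsets of topological spaces carry the subspace topology. Let $\mathcal H$ be a closed linear subspace of $\mathcal C(K,E)$. (1) $\Omega_{\mathcal H}=\{y\in K:\ g(y)\neq 0\text{ for some } g\in\mathcal H\}$. (2) A set $\mathcal B\subseteq K$ is a boundary for $\mathcal H$ if $\|h\|=\sup_{x\in\mathcal B}\|h(x)\|$ for each $h\in\mathcal H$ (with $\sup\emptyset=0$). (3) $\mathcal A$ is the closed linear span in $\mathcal C(K)$ of the functions $x\mapsto\langle e^*,h(x)\rangle$, where $e^*\in E^*$ and $h\in\mathcal H$;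 $\mathcal A^E$ is the set of all $f\in\mathcal A$ such that the function $x\mapsto f(x)e$ belongs to $\mathcal H$ for each $e\in E$. (4) The Choquet boundary $\operatorname{Ch}_{\mathcal H}K$ is the set of those $x\in K$ for which the functional $f\mapsto f(x)$ on $\mathcal A$ is an extreme point of the closed unit ball of $\mathcal A^*$. (5) A point $x\in K$ is a weak peak point with respect to $\mathcal H$ if for each neighbourhood $U$ of $x$ and each $\varepsilon\in(0,1)$ there is $h\in\mathcal A^E$ with $0\le h\le 1$ on $K$, $h(x)>1-\varepsilon$, and $h<\varepsilon$ on $\operatorname{Ch}_{\mathcal H}K\setminus U$. The set of weak peak points is denoted by $\mathcal W_{\mathcal H}$. Statement. For $i=1,2$, let $K_i$ be a compact Hausdorff space, $E_i$ a Banach space and $\mathcal H_i$ a closed linear subspace of $\mathcal C(K_i,E_i)$. Suppose that $E_2$ contains no isomorphic copy of $c_0$, that $\mathcal B\subseteq K_2$ is a closed boundary for $\mathcal H_2$, and that $\mathcal H_1$ is isomorphic (linearly homeomorphic) to a subspace of $\mathcal H_2$. If $\mathcal B^{(k)}\cap\Omega_{\mathcal H_2}=\emptyset$ for some natural number $k$,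 then $\mathcal W_{\mathcal H_1}$ is scattered and its height $ht(\mathcal W_{\mathcal H_1})$ is finite. -/

import Mathlib

open Set Filter Topology
open scoped ZeroAtInfty

universe u v

/-- The derivatives `S^(α)` of a subset `S` of a topological space, `S` carrying the subspace
topology: `S^(0) = S`, `S^(α+1)` is the set of those points of `S^(α)` which are accumulation
points of `S^(α)`, and `S^(α) = ⋂_{β < α} S^(β)` for a limit ordinal `α`. -/
noncomputable def cbDerivative {X : Type u} [TopologicalSpace X] (S : Set X) (α : Ordinal.{u}) :
    Set X :=
  Ordinal.limitRecOn (motive := fun _ => Set X) α S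
    (fun _ D => {x | x ∈ D ∧ AccPt x (𝓟 D)})
    (fun α _ D => ⋂ (β : Ordinal.{u}) (h : β < α), D β h)

theorem cbDerivative_zero {X : Type u} [TopologicalSpace X] (S : Set X) :
    cbDerivative S 0 = S := by
  simp [cbDerivative]

theorem cbDerivative_add_one {X : Type u} [TopologicalSpace X] (S : Set X) (α : Ordinal.{u}) :
    cbDerivative S (α + 1) =
      {x | x ∈ cbDerivative S α ∧ AccPt x (𝓟 (cbDerivative S α))} := by
  simp [cbDerivative]

theorem cbDerivative_limit {X : Type u} [TopologicalSpace X] (S : Set X) (α : Ordinal.{u})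
    (hα : Order.IsSuccLimit α) :
    cbDerivative S α = ⋂ (β : Ordinal.{u}) (_ : β < α), cbDerivative S β := by
  simp only [cbDerivative]
  rw [Ordinal.limitRecOn_limit _ _ _ _ hα]

/-- `S`, with the subspace topology, is scattered: some derivative of `S` is empty. -/
def IsScatteredSet {X : Type u} [TopologicalSpace X] (S : Set X) : Prop :=
  ∃ α : Ordinal.{u}, cbDerivative S α = ∅

/-- The height of `S`: the least ordinal `α` with `S^(α) = ∅`
(meaningful only if `S` is scattered). -/
noncomputable def scatteredHeight {X : Type u} [TopologicalSpace X] (S : Set X) : Ordinal.{u} :=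
  sInf {α : Ordinal.{u} | cbDerivative S α = ∅}

/-- `S` has finite height: `S` is scattered and its height is a natural number. -/
def HasFiniteHeight {X : Type u} [TopologicalSpace X] (S : Set X) : Prop :=
  IsScatteredSet S ∧ ∃ n : ℕ, scatteredHeight S = n

/-- `X` is isomorphic (linearly homeomorphic) to a subspace of `Y`, i.e. `Y` contains an
isomorphic copy of `X`. -/
def EmbedsIsomorphically (X : Type u) (Y : Type v) [NormedAddCommGroup X] [NormedSpace ℝ X]
    [NormedAddCommGroup Y] [NormedSpace ℝ Y] : Prop :=
  ∃ M : Submodule ℝ Y, Nonempty (X ≃L[ℝ] M)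

/-- `E` contains an isomorphic copy of `c_0`, the Banach space of real null sequences. -/
def ContainsCZero (E : Type u) [NormedAddCommGroup E] [NormedSpace ℝ E] : Prop :=
  EmbedsIsomorphically C₀(ℕ, ℝ) E

/-- The closed unit ball of the dual space of `X`. -/
def dualUnitBall (X : Type u) [NormedAddCommGroup X] [NormedSpace ℝ X] : Set (StrongDual ℝ X) :=
  Metric.closedBall 0 1

section FunctionSpaces

variable {K : Type u} [TopologicalSpace K] {E : Type v} [NormedAddCommGroup E] [NormedSpace ℝ E]

/-- The function `e^*(h) : x ↦ ⟨e^*, h(x)⟩`. -/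
def dualComp (φ : StrongDual ℝ E) (h : C(K, E)) : C(K, ℝ) :=
  ⟨fun x => φ (h x), by fun_prop⟩

/-- The function `f ⊗ e : x ↦ f(x) e`. -/
def tensorVec (f : C(K, ℝ)) (e : E) : C(K, E) :=
  ⟨fun x => f x • e, by fun_prop⟩

/-- The set `Ω_H` of points at which some member of `H` does not vanish. -/
def nonvanishingSet (H : Submodule ℝ C(K, E)) : Set K :=
  {y | ∃ g ∈ H, g y ≠ 0}

variable [CompactSpace K]

/-- `B` is a boundary for `H`: `‖h‖ = sup_{x ∈ B} ‖h(x)‖` for every `h ∈ H`. The supremum is over a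
bounded set of nonnegative reals, the supremum over the empty set being `0`. -/
def IsBoundary (H : Submodule ℝ C(K, E)) (B : Set K) : Prop :=
  ∀ h ∈ H, ‖h‖ = ⨆ x : B, ‖h x‖

/-- The canonical scalar function space `A` of `H`: the closed linear span in `C(K)` of all the
functions `e^*(h)` with `e^* ∈ E^*` and `h ∈ H`. -/
noncomputable def scalarSpace (H : Submodule ℝ C(K, E)) : Submodule ℝ C(K, ℝ) :=
  (Submodule.span ℝ {f | ∃ φ : StrongDual ℝ E, ∃ h ∈ H, f = dualComp φ h}).topologicalClosure

/-- The set `A^E` of those `f ∈ A` for which `f ⊗ e ∈ H` for every `e ∈ E`. -/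
def scalarMultipliers (H : Submodule ℝ C(K, E)) : Set C(K, ℝ) :=
  {f | f ∈ scalarSpace H ∧ ∀ e : E, tensorVec f e ∈ H}

/-- The evaluation functional `h ↦ h(x)` on a subspace `A` of `C(K)`. -/
noncomputable def evalOn (A : Submodule ℝ C(K, ℝ)) (x : K) : StrongDual ℝ A :=
  (ContinuousMap.evalCLM ℝ x).comp A.subtypeL

/-- The Choquet boundary of `H`: the points `x` whose evaluation functional is an extreme point of
the closed unit ball of the dual of the scalar function space of `H`. -/
def choquetBoundary (H : Submodule ℝ C(K, E)) : Set K :=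
  {x | evalOn (scalarSpace H) x ∈ (dualUnitBall (scalarSpace H)).extremePoints ℝ}

/-- The set `W_H` of weak peak points with respect to `H`. -/
def weakPeakPoints (H : Submodule ℝ C(K, E)) : Set K :=
  {x | ∀ U ∈ 𝓝 x, ∀ ε : ℝ, 0 < ε → ε < 1 →
    ∃ h ∈ scalarMultipliers H, (∀ y, 0 ≤ h y ∧ h y ≤ 1) ∧ 1 - ε < h x ∧
      ∀ y ∈ choquetBoundary H \ U, h y < ε}

end FunctionSpaces

/-!
Let `T : H₁ → H₂` be an isomorphic embedding and `e` a unit vector of `E₁`; replace `T` by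
`f ↦ T (f ⊗ e)`. Near an accumulation point of weak peak points there are infinitely many of them
with pairwise disjoint neighbourhoods. The corresponding multipliers peak there and are small
elsewhere on the Choquet boundary, which is a boundary for the scalar functions, so their series is
weakly unconditionally Cauchy. As `E₂` contains no `c₀`, the Bessaga–Pełczyński theorem makes their
images under `T` tend to zero at each point of `K₂`. Descending from the `n`-th derivative of the
weak peak points one thus finds `n` multipliers that are all close to `1` at a common point, so that
their sum has norm close to `n`, and whose images are large at most `k` at a time on the boundary
`B`: how many of them may be large at `y ∈ B` is limited by the Cantor–Bendixson rank of `y`. Hence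
the image of the sum has norm at most about `k ‖T‖`, which bounds `n`.
-/

section ExtremePoints

variable {F : Type*} [AddCommGroup F] [Module ℝ F] [TopologicalSpace F]

theorem isCompact_convexJoin [ContinuousAdd F] [ContinuousSMul ℝ F] {s t : Set F}
    (hs : IsCompact s) (ht : IsCompact t) : IsCompact (convexJoin ℝ s t) := by
  have himage : convexJoin ℝ s t =
      (fun p : ℝ × F × F => (1 - p.1) • p.2.1 + p.1 • p.2.2) '' (Icc 0 1 ×ˢ s ×ˢ t) := by
    ext x
    simp only [mem_convexJoin, segment_eq_image, mem_image, mem_prod, Prod.exists]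
    constructor
    · rintro ⟨a, ha, b, hb, θ, hθ, rfl⟩
      exact ⟨θ, a, b, ⟨hθ, ha, hb⟩, rfl⟩
    · rintro ⟨θ, a, b, ⟨hθ, ha, hb⟩, rfl⟩
      exact ⟨a, ha, b, hb, θ, hθ, rfl⟩
  rw [himage]
  exact (isCompact_Icc.prod (hs.prod ht)).image (by fun_prop)

theorem isCompact_convexHull_union [ContinuousAdd F] [ContinuousSMul ℝ F] {s t : Set F}
    (hs : IsCompact (convexHull ℝ s)) (ht : IsCompact (convexHull ℝ t)) :
    IsCompact (convexHull ℝ (s ∪ t)) := by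
  rcases s.eq_empty_or_nonempty with rfl | hs₀
  · rwa [empty_union]
  rcases t.eq_empty_or_nonempty with rfl | ht₀
  · rwa [union_empty]
  rw [convexHull_union hs₀ ht₀]
  exact isCompact_convexJoin hs ht

theorem isCompact_convexHull_biUnion [ContinuousAdd F] [ContinuousSMul ℝ F] {ι : Type*}
    {C : ι → Set F} (t : Finset ι) (hC : ∀ i ∈ t, IsCompact (C i)) (hC' : ∀ i ∈ t, Convex ℝ (C i)) :
    IsCompact (convexHull ℝ (⋃ i ∈ t, C i)) := by
  classical
  induction t using Finset.induction_on with
  | empty => simp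
  | insert i t _ ih =>
    rw [Finset.forall_mem_insert] at hC hC'
    rw [Finset.set_biUnion_insert]
    exact isCompact_convexHull_union (by rw [hC'.1.convexHull_eq]; exact hC.1) (ih hC.2 hC'.2)

variable [T2Space F] [IsTopologicalAddGroup F] [ContinuousSMul ℝ F] [LocallyConvexSpace ℝ F]
  {s : Set F}

/-- **Milman's converse to the Krein–Milman theorem**. -/
theorem extremePoints_subset_of_subset_closure_convexHull {Q : Set F} (hs : IsCompact s)
    (hsconv : Convex ℝ s) (hQ : IsCompact Q) (hQs : Q ⊆ s) (hsQ : s ⊆ closure (convexHull ℝ Q)) :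
    s.extremePoints ℝ ⊆ Q := by
  intro x hx
  by_contra hxQ
  have hsep : ∀ q ∈ Q, ∃ (l : StrongDual ℝ F) (c : ℝ), l q < c ∧ c < l x := fun q hq => by
    obtain ⟨l, hl⟩ := geometric_hahn_banach_point_point (ne_of_mem_of_not_mem hq hxQ)
    exact ⟨l, exists_between hl⟩
  choose! l c hlc hcx using hsep
  obtain ⟨t, htQ, hQt⟩ := hQ.elim_nhds_subcover (fun q => {z | l q z < c q}) fun q hq =>
    (isOpen_lt (l q).continuous continuous_const).mem_nhds (hlc q hq)
  -- The finitely many slices `C q` cover `Q` and miss `x`, but the hull of their union is `s`.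
  let C : F → Set F := fun q => s ∩ {z | l q z ≤ c q}
  have hQC : Q ⊆ ⋃ q ∈ t, C q := fun z hz => by
    obtain ⟨q, hq, hzq⟩ := mem_iUnion₂.1 (hQt hz)
    exact mem_iUnion₂.2 ⟨q, hq, hQs hz, le_of_lt (show l q z < c q from hzq)⟩
  have hcompact : IsCompact (convexHull ℝ (⋃ q ∈ t, C q)) :=
    isCompact_convexHull_biUnion t
      (fun q _ => hs.inter_right (isClosed_le (l q).continuous continuous_const))
      fun q _ => hsconv.inter (convex_halfSpace_le (l q).toLinearMap.isLinear _)
  have hhull : convexHull ℝ (⋃ q ∈ t, C q) = s :=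
    (convexHull_min (iUnion₂_subset fun _ _ => inter_subset_left) hsconv).antisymm
      (hsQ.trans (closure_minimal (convexHull_mono hQC) hcompact.isClosed))
  rw [← hhull] at hx
  obtain ⟨q, hq, -, hxq⟩ := mem_iUnion₂.1 (extremePoints_convexHull_subset hx)
  exact (hcx q (htQ q hq)).not_ge hxq

theorem exists_mem_extremePoints_forall_apply_le (hs : IsCompact s) (hs₀ : s.Nonempty)
    (l : StrongDual ℝ F) : ∃ x ∈ s.extremePoints ℝ, ∀ y ∈ s, l y ≤ l x := by
  have hexp : IsExposed ℝ s {x ∈ s | ∀ y ∈ s, l y ≤ l x} := fun _ => ⟨l, rfl⟩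
  obtain ⟨x₀, hx₀⟩ := hs.exists_isMaxOn hs₀ l.continuous.continuousOn
  obtain ⟨x, hx⟩ := (hexp.isCompact hs).extremePoints_nonempty ⟨x₀, hx₀⟩
  exact ⟨x, hexp.isExtreme.extremePoints_subset_extremePoints hx, hx.1.2⟩

end ExtremePoints

section DualUnitBall

variable {X : Type u} [NormedAddCommGroup X] [NormedSpace ℝ X]

theorem neg_mem_extremePoints_dualUnitBall {φ : StrongDual ℝ X}
    (hφ : φ ∈ (dualUnitBall X).extremePoints ℝ) : -φ ∈ (dualUnitBall X).extremePoints ℝ := by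
  have h := mem_image_of_mem (LinearEquiv.neg ℝ) hφ
  rw [image_extremePoints] at h
  simpa [dualUnitBall] using h

theorem locallyConvexSpace_weakDual : LocallyConvexSpace ℝ (WeakDual ℝ X) :=
  inferInstanceAs (LocallyConvexSpace ℝ (WeakBilin (topDualPairing ℝ X)))

theorem toStrongDual_preimage_dualUnitBall_subset_closure_convexHull {Q : Set (WeakDual ℝ X)}
    (hQ : ∀ a r, (∀ ψ ∈ Q, ψ a ≤ r) → ‖a‖ ≤ r) :
    WeakDual.toStrongDual ⁻¹' dualUnitBall X ⊆ closure (convexHull ℝ Q) := by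
  have := locallyConvexSpace_weakDual (X := X)
  intro φ hφ
  by_contra hφQ
  obtain ⟨g, r, hg, hr⟩ := geometric_hahn_banach_closed_point
    (convex_convexHull ℝ Q).closure isClosed_closure hφQ
  obtain ⟨a, rfl⟩ := LinearMap.dualEmbedding_surjective (topDualPairing ℝ X) g
  have har : ‖a‖ ≤ r :=
    hQ a r fun ψ hψ => (hg ψ (subset_closure (subset_convexHull ℝ Q hψ))).le
  have hφa : φ a ≤ 1 * ‖a‖ := (le_abs_self _).trans
    ((WeakDual.toStrongDual φ).le_of_opNorm_le (mem_closedBall_zero_iff.1 hφ) a)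
  have hrφ : r < φ a := hr
  linarith

/-- The extreme points of the dual ball lie in the weak-star compact set `± f(K)`, whose weak-star
closed convex hull is the ball because `f` is norming. -/
theorem exists_mem_extremePoints_dualUnitBall_abs_apply_eq_norm {K : Type*} [TopologicalSpace K]
    [CompactSpace K] [Nonempty K] {f : K → StrongDual ℝ X} (hf : ∀ a, Continuous fun y => f y a)
    (hf₁ : ∀ y, ‖f y‖ ≤ 1) (hfn : ∀ a r, (∀ y, |f y a| ≤ r) → ‖a‖ ≤ r) (a : X) :
    ∃ y, f y ∈ (dualUnitBall X).extremePoints ℝ ∧ |f y a| = ‖a‖ := by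
  have := locallyConvexSpace_weakDual (X := X)
  let s : Set (WeakDual ℝ X) := WeakDual.toStrongDual ⁻¹' dualUnitBall X
  let e : K → WeakDual ℝ X := fun y => StrongDual.toWeakDual (f y)
  let Q : Set (WeakDual ℝ X) := range e ∪ range fun y => -e y
  have hs : IsCompact s := WeakDual.isCompact_closedBall (𝕜 := ℝ) (E := X) 0 1
  have hsconv : Convex ℝ s := (convex_closedBall (0 : StrongDual ℝ X) 1).linear_preimage
    (WeakDual.toStrongDual (𝕜 := ℝ) (E := X)).toLinearMap
  have he : Continuous e := WeakBilin.continuous_of_continuous_eval _ hf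
  have hQ : IsCompact Q := (isCompact_range he).union (isCompact_range he.neg)
  have hQs : Q ⊆ s := by
    rintro _ (⟨y, rfl⟩ | ⟨y, rfl⟩)
    · exact mem_closedBall_zero_iff.2 (hf₁ y)
    · exact mem_closedBall_zero_iff.2 ((norm_neg _).trans_le (hf₁ y))
  have hsQ : s ⊆ closure (convexHull ℝ Q) :=
    toStrongDual_preimage_dualUnitBall_subset_closure_convexHull fun b r hb =>
      hfn b r fun y => abs_le'.2 ⟨hb _ (.inl ⟨y, rfl⟩), hb _ (.inr ⟨y, rfl⟩)⟩
  let evalA : StrongDual ℝ (WeakDual ℝ X) := WeakBilin.eval (topDualPairing ℝ X) a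
  obtain ⟨φ, hφ, hmax⟩ := exists_mem_extremePoints_forall_apply_le hs
    ((range_nonempty e).mono (subset_union_left.trans hQs)) evalA
  have hnorm : ‖a‖ ≤ φ a := hfn a _ fun y =>
    abs_le'.2 ⟨hmax _ (hQs (.inl ⟨y, rfl⟩)), hmax _ (hQs (.inr ⟨y, rfl⟩))⟩
  have hle : ∀ y, |f y a| ≤ ‖a‖ := fun y => by
    simpa using (f y).le_of_opNorm_le (hf₁ y) a
  have hφ' : WeakDual.toStrongDual φ ∈ (dualUnitBall X).extremePoints ℝ := hφ
  rcases extremePoints_subset_of_subset_closure_convexHull hs hsconv hQ hQs hsQ hφ with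
    ⟨y, rfl⟩ | ⟨y, rfl⟩
  · exact ⟨y, hφ', (hle y).antisymm (hnorm.trans (le_abs_self _))⟩
  · refine ⟨y, ?_, (hle y).antisymm (hnorm.trans (neg_le_abs _))⟩
    have := neg_mem_extremePoints_dualUnitBall hφ'
    rwa [map_neg, neg_neg] at this

end DualUnitBall

section Boundary

variable {K : Type u} [TopologicalSpace K] [CompactSpace K]
  {E : Type v} [NormedAddCommGroup E] [NormedSpace ℝ E]

theorem isBoundary_iff {H : Submodule ℝ C(K, E)} {B : Set K} :
    IsBoundary H B ↔ ∀ h ∈ H, ∀ r : ℝ, 0 ≤ r → (∀ x ∈ B, ‖h x‖ ≤ r) → ‖h‖ ≤ r := by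
  refine ⟨fun hB h hh r hr hr' => ?_, fun hB h hh => le_antisymm ?_ ?_⟩
  · rw [hB h hh]
    exact Real.iSup_le (fun x => hr' x x.2) hr
  · refine hB h hh _ (Real.iSup_nonneg fun x => norm_nonneg _) fun x hx => ?_
    exact le_ciSup (f := fun x : B => ‖h x‖)
      ⟨‖h‖, forall_mem_range.2 fun x => h.norm_coe_le_norm x⟩ ⟨x, hx⟩
  · exact Real.iSup_le (fun x => h.norm_coe_le_norm x) (norm_nonneg h)

theorem IsBoundary.anti {H H' : Submodule ℝ C(K, E)} {B : Set K} (hB : IsBoundary H' B)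
    (hH : H ≤ H') : IsBoundary H B :=
  fun h hh => hB h (hH hh)

theorem isBoundary_setOf_evalOn_mem_extremePoints (A : Submodule ℝ C(K, ℝ)) :
    IsBoundary A {x | evalOn A x ∈ (dualUnitBall A).extremePoints ℝ} := by
  refine isBoundary_iff.2 fun a ha r hr har => ?_
  rcases isEmpty_or_nonempty K with _ | _
  · exact (ContinuousMap.norm_le a hr).2 isEmptyElim
  obtain ⟨y, hy, hya⟩ := exists_mem_extremePoints_dualUnitBall_abs_apply_eq_norm
    (X := A) (f := evalOn A) (a := ⟨a, ha⟩) (fun b => (b : C(K, ℝ)).continuous)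
    (fun y => ContinuousLinearMap.opNorm_le_bound _ zero_le_one fun b => by
      rw [one_mul]
      exact (b : C(K, ℝ)).norm_coe_le_norm y)
    (fun b r hb => (ContinuousMap.norm_le_of_nonempty (b : C(K, ℝ))).2 hb)
  exact hya.ge.trans (har y hy)

theorem isBoundary_choquetBoundary (H : Submodule ℝ C(K, E)) :
    IsBoundary (scalarSpace H) (choquetBoundary H) :=
  isBoundary_setOf_evalOn_mem_extremePoints _

end Boundary

section CZero

theorem embedsIsomorphically_iff {X : Type u} {Y : Type v} [NormedAddCommGroup X] [NormedSpace ℝ X]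
    [NormedAddCommGroup Y] [NormedSpace ℝ Y] :
    EmbedsIsomorphically X Y ↔ ∃ (T : X →L[ℝ] Y) (c : NNReal), AntilipschitzWith c T := by
  constructor
  · rintro ⟨M, ⟨Φ⟩⟩
    exact ⟨M.subtypeL.comp Φ.toContinuousLinearMap, _,
      M.subtypeₗᵢ.antilipschitz.comp Φ.antilipschitz⟩
  · rintro ⟨T, c, hT⟩
    let Φ := LinearEquiv.ofInjective (T : X →ₗ[ℝ] Y) hT.injective
    refine ⟨_, ⟨Φ.toContinuousLinearEquivOfBounds ‖T‖ c T.le_opNorm fun y => ?_⟩⟩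
    obtain ⟨x, rfl⟩ := Φ.surjective y
    rw [Φ.symm_apply_apply]
    exact ZeroHomClass.bound_of_antilipschitz T hT x

/-- **Rosenthal's lemma**. Split the indices into the infinitely many blocks `{Nat.pair p q | q}`:
either one of them works, or each contains a row in which the block contributes more than `δ`, and
those rows, restricted to one another, have row sums smaller by `δ`. -/
theorem exists_injective_forall_sum_le {δ : ℝ} (hδ : 0 ≤ δ) (j : ℕ) (a : ℕ → ℕ → ℝ)
    (ha : ∀ n, ∀ F : Finset ℕ, ∑ m ∈ F, a n m ≤ j * δ) :
    ∃ g : ℕ → ℕ, Function.Injective g ∧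
      ∀ n, ∀ F : Finset ℕ, n ∉ F → ∑ m ∈ F, a (g n) (g m) ≤ δ := by
  induction j generalizing a with
  | zero => exact ⟨id, Function.injective_id, fun n F _ => (ha n F).trans (by simpa using hδ)⟩
  | succ j ih =>
    have hblock (p : ℕ) : Function.Injective (Nat.pair p) := fun _ _ h => (Nat.pair_eq_pair.1 h).2
    by_cases hp : ∃ p, ∀ n, ∀ F : Finset ℕ, n ∉ F → ∑ m ∈ F, a (.pair p n) (.pair p m) ≤ δ
    · obtain ⟨p, hp⟩ := hp
      exact ⟨Nat.pair p, hblock p, hp⟩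
    push Not at hp
    choose q F hqF hF using hp
    have hrow : Function.Injective fun p => Nat.pair p (q p) :=
      fun _ _ h => (Nat.pair_eq_pair.1 h).1
    obtain ⟨g, hg, hgs⟩ := ih (fun p p' => a (p.pair (q p)) (p'.pair (q p'))) fun p G => by
      have hdisj : Disjoint (G.map ⟨_, hrow⟩) ((F p).map ⟨_, hblock p⟩) := by
        simp only [Finset.disjoint_left, Finset.mem_map, Function.Embedding.coeFn_mk]
        rintro _ ⟨p', -, rfl⟩ ⟨m, hm, h⟩
        obtain ⟨rfl, rfl⟩ := Nat.pair_eq_pair.1 h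
        exact hqF _ hm
      have hsum := ha (p.pair (q p)) (Finset.disjUnion _ _ hdisj)
      rw [Finset.sum_disjUnion, Finset.sum_map, Finset.sum_map] at hsum
      simp only [Function.Embedding.coeFn_mk, Nat.cast_succ] at hsum
      linarith [hF p]
    exact ⟨_, hrow.comp hg, hgs⟩

variable {E : Type v} [NormedAddCommGroup E] [NormedSpace ℝ E]

theorem abs_mul_abs_apply_le_norm_sum_add {ι : Type*} [DecidableEq ι] {v : ι → E}
    {φ : StrongDual ℝ E} (hφ : ‖φ‖ ≤ 1) {F : Finset ι} {n : ι} (hn : n ∈ F) {c : ι → ℝ} {r : ℝ}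
    (hc : ∀ i ∈ F, |c i| ≤ r) :
    |c n| * |φ (v n)| ≤ ‖∑ i ∈ F, c i • v i‖ + r * ∑ i ∈ F.erase n, |φ (v i)| := by
  have hsplit : c n * φ (v n) =
      φ (∑ i ∈ F, c i • v i) - ∑ i ∈ F.erase n, c i * φ (v i) := by
    rw [map_sum, ← Finset.add_sum_erase F _ hn]
    simp
  rw [← abs_mul, hsplit]
  refine (abs_sub _ _).trans (add_le_add ?_ ?_)
  · simpa using φ.le_of_opNorm_le hφ (∑ i ∈ F, c i • v i)
  · rw [Finset.mul_sum]
    refine (Finset.abs_sum_le_sum_abs _ _).trans (Finset.sum_le_sum fun i hi => ?_)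
    rw [abs_mul]
    gcongr
    exact hc i (Finset.mem_of_mem_erase hi)

/-- The series `∑ v i` is weakly unconditionally Cauchy, with constant `M`: its finite sums
`∑ c i • v i` with coefficients `|c i| ≤ 1` are bounded by `M`. -/
def UnconditionallyBoundedBy (v : ℕ → E) (M : ℝ) : Prop :=
  ∀ (F : Finset ℕ) (c : ℕ → ℝ), (∀ i ∈ F, |c i| ≤ 1) → ‖∑ i ∈ F, c i • v i‖ ≤ M

namespace UnconditionallyBoundedBy

variable {v : ℕ → E} {M : ℝ}

theorem nonneg (hv : UnconditionallyBoundedBy v M) : 0 ≤ M := by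
  simpa using hv ∅ 0 (by simp)

theorem comp (hv : UnconditionallyBoundedBy v M) {g : ℕ → ℕ} (hg : Function.Injective g) :
    UnconditionallyBoundedBy (v ∘ g) M := by
  intro F c hc
  simpa [Function.leftInverse_invFun hg _] using
    hv (F.map ⟨g, hg⟩) (c ∘ Function.invFun g)
      (by simpa [Function.leftInverse_invFun hg _] using hc)

theorem map {E' : Type*} [NormedAddCommGroup E'] [NormedSpace ℝ E']
    (hv : UnconditionallyBoundedBy v M) (S : E →L[ℝ] E') :
    UnconditionallyBoundedBy (S ∘ v) (‖S‖ * M) := by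
  intro F c hc
  simpa using S.le_opNorm_of_le (hv F c hc)

theorem norm_sum_le (hv : UnconditionallyBoundedBy v M) {F : Finset ℕ} {c : ℕ → ℝ} {r : ℝ}
    (hr : 0 ≤ r) (hc : ∀ i ∈ F, |c i| ≤ r) : ‖∑ i ∈ F, c i • v i‖ ≤ r * M := by
  have hscale : ∑ i ∈ F, c i • v i = r • ∑ i ∈ F, (c i / r) • v i := by
    rw [Finset.smul_sum]
    refine Finset.sum_congr rfl fun i hi => ?_
    rw [smul_smul, mul_div_cancel_of_imp']
    rintro rfl
    exact abs_nonpos_iff.1 (hc i hi)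
  rw [hscale, norm_smul, Real.norm_of_nonneg hr]
  gcongr
  refine hv F _ fun i hi => ?_
  rw [abs_div, abs_of_nonneg hr]
  exact div_le_one_of_le₀ (hc i hi) hr

theorem sum_abs_apply_le (hv : UnconditionallyBoundedBy v M) {φ : StrongDual ℝ E} (hφ : ‖φ‖ ≤ 1)
    (F : Finset ℕ) : ∑ i ∈ F, |φ (v i)| ≤ M := by
  have hsign : ‖∑ i ∈ F, (SignType.sign (φ (v i)) : ℝ) • v i‖ ≤ M := hv F _ fun i _ => by
    rcases lt_trichotomy (φ (v i)) 0 with h | h | h <;> simp [h]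
  calc ∑ i ∈ F, |φ (v i)|
      = φ (∑ i ∈ F, (SignType.sign (φ (v i)) : ℝ) • v i) := by simp [sign_mul_self]
    _ ≤ 1 * M := (le_abs_self _).trans (φ.le_of_opNorm_le_of_le hφ hsign)
    _ = M := one_mul M

theorem summable [CompleteSpace E] (hv : UnconditionallyBoundedBy v M) (c : C₀(ℕ, ℝ)) :
    Summable fun i => c i • v i := by
  rw [summable_iff_vanishing_norm]
  intro ε hε
  have hM := hv.nonneg
  obtain ⟨r, hr, hrε⟩ : ∃ r > 0, r * M < ε :=
    ⟨ε / (M + 1), by positivity, by rw [div_mul_eq_mul_div, div_lt_iff₀ (by positivity)]; linarith⟩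
  have hlarge : {i | ¬ |c i| ≤ r}.Finite := by
    have hc := c.zero_at_infty'
    rw [cocompact_eq_cofinite] at hc
    simpa [Filter.eventually_cofinite] using
      hc.eventually (Metric.closedBall_mem_nhds (0 : ℝ) hr)
  refine ⟨hlarge.toFinset, fun F hF => (hv.norm_sum_le hr.le fun i hi => ?_).trans_lt hrε⟩
  by_contra hir
  exact Finset.disjoint_left.1 hF hi (hlarge.mem_toFinset.2 hir)

theorem exists_continuousLinearMap_hasSum [CompleteSpace E] (hv : UnconditionallyBoundedBy v M) :
    ∃ T : C₀(ℕ, ℝ) →L[ℝ] E, ∀ c, HasSum (fun i => c i • v i) (T c) := by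
  let T : C₀(ℕ, ℝ) →ₗ[ℝ] E :=
    { toFun := fun c => ∑' i, c i • v i
      map_add' := fun c d => by
        simp [add_smul, (hv.summable c).tsum_add (hv.summable d)]
      map_smul' := fun r c => by
        simp [mul_smul, (hv.summable c).tsum_const_smul] }
  refine ⟨T.mkContinuous M fun c => ?_, fun c => (hv.summable c).hasSum⟩
  rw [mul_comm]
  exact le_of_tendsto' (hv.summable c).hasSum.norm fun F =>
    hv.norm_sum_le (norm_nonneg c) fun i _ => c.toBCF.norm_coe_le_norm i

/-- **Bessaga–Pełczyński**. -/
theorem containsCZero [CompleteSpace E] (hv : UnconditionallyBoundedBy v M) {δ : ℝ} (hδ : 0 < δ)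
    (hvδ : ∀ i, δ ≤ ‖v i‖) : ContainsCZero E := by
  choose φ hφ hφv using fun i => exists_dual_vector'' ℝ (v i)
  obtain ⟨j, hj⟩ := exists_nat_ge (M / (δ / 2))
  obtain ⟨g, hg, hgφ⟩ := exists_injective_forall_sum_le (half_pos hδ).le j
    (fun n m => |φ n (v m)|)
    fun n F => (hv.sum_abs_apply_le (hφ n) F).trans ((div_le_iff₀ (half_pos hδ)).1 hj)
  obtain ⟨T, hT⟩ := (hv.comp hg).exists_continuousLinearMap_hasSum
  have hcoord (c : C₀(ℕ, ℝ)) (n : ℕ) : |c n| * δ ≤ ‖T c‖ + ‖c‖ * (δ / 2) := by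
    refine ge_of_tendsto ((hT c).norm.add_const _) ?_
    filter_upwards [eventually_ge_atTop {n}] with F hF
    calc |c n| * δ ≤ |c n| * |φ (g n) (v (g n))| := by
          rw [hφv, RCLike.ofReal_real_eq_id, id, abs_norm]
          gcongr
          exact hvδ _
      _ ≤ ‖∑ i ∈ F, c i • (v ∘ g) i‖ + ‖c‖ * ∑ i ∈ F.erase n, |φ (g n) ((v ∘ g) i)| :=
        abs_mul_abs_apply_le_norm_sum_add (v := v ∘ g) (c := c) (hφ _)
          (hF (Finset.mem_singleton_self n)) fun i _ => c.toBCF.norm_coe_le_norm i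
      _ ≤ _ := by
        gcongr
        exact hgφ n _ (Finset.notMem_erase n F)
  refine embedsIsomorphically_iff.2 ⟨T, (2 / δ).toNNReal, T.antilipschitz_of_bound fun c => ?_⟩
  have hc : ‖c‖ ≤ (‖T c‖ + ‖c‖ * (δ / 2)) / δ :=
    (BoundedContinuousFunction.norm_le (f := c.toBCF) (by positivity)).2 fun n =>
      (le_div_iff₀ hδ).2 (hcoord c n)
  rw [le_div_iff₀ hδ] at hc
  rw [Real.coe_toNNReal _ (by positivity), div_mul_eq_mul_div, le_div_iff₀ hδ]
  linarith

theorem finite_setOf_le_norm [CompleteSpace E] (hv : UnconditionallyBoundedBy v M)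
    (hE : ¬ ContainsCZero E) {ε : ℝ} (hε : 0 < ε) : {i | ε ≤ ‖v i‖}.Finite := by
  by_contra hinf
  let g := Set.Infinite.natEmbedding _ hinf
  exact hE ((hv.comp (Subtype.val_injective.comp g.injective)).containsCZero hε fun n => (g n).2)

end UnconditionallyBoundedBy

end CZero

section Derivatives

variable {X : Type u} [TopologicalSpace X]

theorem cbDerivative_eq_iteratedDerivedSet (S : Set X) (α : Ordinal.{u}) :
    cbDerivative S α = CantorBendixson.iteratedDerivedSet S α := by
  induction α using Ordinal.limitRecOn with
  | zero => rw [cbDerivative_zero, CantorBendixson.iteratedDerivedSet_zero]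
  | add_one α ih =>
    rw [cbDerivative_add_one, CantorBendixson.iteratedDerivedSet_succ, ← ih]
    exact inter_comm _ _
  | limit α hα ih =>
    rw [cbDerivative_limit S α hα, CantorBendixson.iteratedDerivedSet_limit hα, iInter_subtype]
    exact iInter₂_congr ih

theorem cbDerivative_subset (S : Set X) (α : Ordinal.{u}) : cbDerivative S α ⊆ S := by
  rw [cbDerivative_eq_iteratedDerivedSet]
  simpa using CantorBendixson.iteratedDerivedSet_antitone S zero_le

theorem isClosed_cbDerivative {S : Set X} (hS : IsClosed S) (α : Ordinal.{u}) :
    IsClosed (cbDerivative S α) := by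
  rw [cbDerivative_eq_iteratedDerivedSet]
  exact CantorBendixson.isClosed_iteratedDerivedSet hS α

theorem mem_cbDerivative_natCast_succ {S : Set X} {n : ℕ} {x : X} :
    x ∈ cbDerivative S ((n + 1 : ℕ) : Ordinal.{u}) ↔
      x ∈ cbDerivative S (n : Ordinal.{u}) ∧ AccPt x (𝓟 (cbDerivative S (n : Ordinal.{u}))) := by
  rw [Nat.cast_succ, cbDerivative_add_one]
  rfl

theorem hasFiniteHeight_of_cbDerivative_natCast_eq_empty {S : Set X} {n : ℕ}
    (h : cbDerivative S (n : Ordinal.{u}) = ∅) : HasFiniteHeight S := by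
  have hle : scatteredHeight S ≤ n := csInf_le' h
  exact ⟨⟨n, h⟩, Ordinal.lt_omega0.1 (hle.trans_lt (Ordinal.natCast_lt_omega0 n))⟩

/-- The natural number valued function `N` is an admissible count relative to `B` and `k`: it is
upper semicontinuous and leaves room for the Cantor–Bendixson rank, that is, `N y ≤ k - r` for
each `y` in the `r`-th derivative of `B`, `r ≤ k`. -/
structure IsCorankCount (B : Set X) (k : ℕ) (N : X → ℕ) : Prop where
  upperSemicontinuous : UpperSemicontinuous N
  add_le : ∀ r ≤ k, ∀ y ∈ cbDerivative B (r : Ordinal.{u}), N y + r ≤ k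

namespace IsCorankCount

variable {B : Set X} {k : ℕ} {N : X → ℕ}

theorem zero (B : Set X) (k : ℕ) : IsCorankCount B k 0 :=
  ⟨upperSemicontinuous_const, fun r hr y _ => by simpa using hr⟩

theorem le (hN : IsCorankCount B k N) {y : X} (hy : y ∈ B) : N y ≤ k :=
  hN.add_le 0 k.zero_le y (by rwa [Nat.cast_zero, cbDerivative_zero])

/-- An accumulation point of the points of `B^(r)` at which the constraint is tight would lie in
`B^(r+1)`, where upper semicontinuity contradicts the next constraint. -/
theorem finite_setOf_le_add [CompactSpace X] (hB : IsClosed B) (hN : IsCorankCount B k N) :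
    {y | ∃ r < k, y ∈ cbDerivative B (r : Ordinal.{u}) ∧ k ≤ N y + r}.Finite := by
  have hunion : {y | ∃ r < k, y ∈ cbDerivative B (r : Ordinal.{u}) ∧ k ≤ N y + r} =
      ⋃ r ∈ Iio k, {y | y ∈ cbDerivative B (r : Ordinal.{u}) ∧ k ≤ N y + r} := by
    ext y
    simp [and_left_comm]
  rw [hunion]
  refine (finite_Iio k).biUnion fun r hr => ?_
  by_contra hinf
  obtain ⟨z, hz⟩ := Set.Infinite.exists_accPt_principal hinf
  have hz_acc : AccPt z (𝓟 (cbDerivative B (r : Ordinal.{u}))) :=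
    hz.mono (principal_mono.2 fun y hy => hy.1)
  have hz_mem : z ∈ cbDerivative B (r : Ordinal.{u}) :=
    isClosed_iff_clusterPt.1 (isClosed_cbDerivative hB r) z hz_acc.clusterPt
  have hNz := hN.add_le (r + 1) hr z (mem_cbDerivative_natCast_succ.2 ⟨hz_mem, hz_acc⟩)
  have hlt : ∀ᶠ y in 𝓝 z, N y < N z + 1 := hN.upperSemicontinuous z _ (Nat.lt_succ_self _)
  obtain ⟨y, ⟨-, -, hy⟩, hyz⟩ := ((accPt_iff_frequently.1 hz).and_eventually hlt).exists
  omega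

theorem add_indicator (hN : IsCorankCount B k N) {Z : Set X} (hZ : IsClosed Z)
    (hZN : ∀ r ≤ k, ∀ y ∈ cbDerivative B (r : Ordinal.{u}), k ≤ N y + r → y ∉ Z) :
    IsCorankCount B k fun y => N y + Z.indicator (fun _ => 1) y where
  upperSemicontinuous :=
    hN.upperSemicontinuous.add (hZ.upperSemicontinuous_indicator zero_le_one)
  add_le r hr y hy := by
    have hNy := hN.add_le r hr y hy
    by_cases hyZ : y ∈ Z
    · have := mt (hZN r hr y hy) (not_not.2 hyZ)
      rw [indicator_of_mem hyZ]
      omega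
    · rwa [indicator_of_notMem hyZ]

end IsCorankCount

theorem exists_seq_pairwise_disjoint_nhds_of_accPt [T2Space X] {S U : Set X} {x : X}
    (hx : AccPt x (𝓟 S)) (hU : U ∈ 𝓝 x) :
    ∃ (p : ℕ → X) (V : ℕ → Set X), (∀ n, p n ∈ S ∩ U) ∧ (∀ n, V n ∈ 𝓝 (p n)) ∧
      Pairwise (Function.onFun Disjoint V) := by
  obtain ⟨f, hf, hdisj⟩ := exists_seq_of_forall_finset_exists'
    (fun a : X × Set X => a.1 ∈ S ∩ U ∧ a.2 ∈ 𝓝 a.1 ∧ a.2ᶜ ∈ 𝓝 x)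
    (fun a b => Disjoint a.2 b.2) fun s hs => by
      have hW : U ∩ ⋂ a ∈ s, a.2ᶜ ∈ 𝓝 x :=
        inter_mem hU ((biInter_finset_mem s).2 fun a ha => (hs a ha).2.2)
      obtain ⟨O, hOW, hO, hxO⟩ := mem_nhds_iff.1 hW
      obtain ⟨q, ⟨hqO, hqS⟩, hqx⟩ := accPt_iff_nhds.1 hx O (hO.mem_nhds hxO)
      obtain ⟨G, G', hG, hG', hqG, hxG', hGG'⟩ := t2_separation hqx
      refine ⟨(q, G ∩ O), ⟨⟨hqS, (hOW hqO).1⟩, (hG.inter hO).mem_nhds ⟨hqG, hqO⟩,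
        mem_of_superset (hG'.mem_nhds hxG') fun y hy hy' => disjoint_left.1 hGG' hy'.1 hy⟩,
        fun a ha => disjoint_left.2 fun y hya hy => ?_⟩
      exact mem_iInter₂.1 (hOW hy.2).2 a ha hya
  exact ⟨fun n => (f n).1, fun n => (f n).2, fun n => (hf n).1, fun n => (hf n).2.1, hdisj⟩

end Derivatives

section WeakPeakSet

variable {K : Type u} [TopologicalSpace K] {M : Submodule ℝ C(K, ℝ)} {D : Set K}

/-- The weak peak points of a space `M` of scalar functions, smallness being tested on `D`; so
`weakPeakPoints H` is the case where `M` consists of the multipliers of `H` and `D` is the Choquet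
boundary of `H`. -/
def weakPeakSet (M : Submodule ℝ C(K, ℝ)) (D : Set K) : Set K :=
  {x | ∀ U ∈ 𝓝 x, ∀ ε : ℝ, 0 < ε → ε < 1 →
    ∃ h ∈ M, (∀ y, 0 ≤ h y ∧ h y ≤ 1) ∧ 1 - ε < h x ∧ ∀ y ∈ D \ U, h y < ε}

theorem sum_le_one_add_sum_of_pairwise_disjoint {ι X : Type*} {V : ι → Set X}
    (hV : Pairwise (Function.onFun Disjoint V)) {t ε : ι → ℝ} {y : X} (hε : ∀ i, 0 ≤ ε i)
    (ht : ∀ i, t i ≤ 1) (htε : ∀ i, y ∉ V i → t i ≤ ε i) (F : Finset ι) :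
    ∑ i ∈ F, t i ≤ 1 + ∑ i ∈ F, ε i := by
  have hti (i : ι) : t i ≤ (V i).indicator 1 y + ε i := by
    by_cases hi : y ∈ V i
    · rw [indicator_of_mem hi]
      exact (ht i).trans (le_add_of_nonneg_right (hε i))
    · rw [indicator_of_notMem hi, zero_add]
      exact htε i hi
  have hind : ∑ i ∈ F, (V i).indicator (1 : X → ℝ) y ≤ 1 := by
    rw [← Finset.indicator_biUnion_apply F V fun i _ j _ hij => hV hij]
    exact indicator_le_self' (fun _ _ => zero_le_one) y
  calc ∑ i ∈ F, t i ≤ ∑ i ∈ F, ((V i).indicator 1 y + ε i) := Finset.sum_le_sum fun i _ => hti i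
    _ ≤ 1 + ∑ i ∈ F, ε i := by
      rw [Finset.sum_add_distrib]
      gcongr

variable [CompactSpace K]

theorem unconditionallyBoundedBy_of_small_off_pairwise_disjoint (hD : IsBoundary M D)
    {V : ℕ → Set K} (hV : Pairwise (Function.onFun Disjoint V)) {ε : ℕ → ℝ} (hε : ∀ i, 0 ≤ ε i)
    {r : ℝ} (hεr : ∀ F : Finset ℕ, ∑ i ∈ F, ε i ≤ r) {f : ℕ → M}
    (hf : ∀ i y, 0 ≤ (f i : C(K, ℝ)) y ∧ (f i : C(K, ℝ)) y ≤ 1)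
    (hfV : ∀ i, ∀ y ∈ D \ V i, (f i : C(K, ℝ)) y ≤ ε i) :
    UnconditionallyBoundedBy f (1 + r) := by
  intro F c hc
  have hr : 0 ≤ r := by simpa using hεr ∅
  refine isBoundary_iff.1 hD _ (∑ i ∈ F, c i • f i).2 _ (by positivity) fun y hy => ?_
  calc ‖((∑ i ∈ F, c i • f i : M) : C(K, ℝ)) y‖ = |∑ i ∈ F, c i * (f i : C(K, ℝ)) y| := by
        simp
    _ ≤ ∑ i ∈ F, (f i : C(K, ℝ)) y := by
        refine (Finset.abs_sum_le_sum_abs _ _).trans (Finset.sum_le_sum fun i hi => ?_)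
        rw [abs_mul, abs_of_nonneg (hf i y).1]
        exact mul_le_of_le_one_left (hf i y).1 (hc i hi)
    _ ≤ 1 + ∑ i ∈ F, ε i := sum_le_one_add_sum_of_pairwise_disjoint hV hε
        (fun i => (hf i y).2) (fun i hi => hfV i y ⟨hy, hi⟩) F
    _ ≤ 1 + r := by
        gcongr
        exact hεr F

theorem exists_seq_peak_unconditionallyBoundedBy [T2Space K] (hD : IsBoundary M D) {S U : Set K}
    (hS : S ⊆ weakPeakSet M D) {x : K} (hx : AccPt x (𝓟 S)) (hU : U ∈ 𝓝 x) {ε : ℝ} (hε : 0 < ε) :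
    ∃ (p : ℕ → K) (f : ℕ → M), (∀ n, p n ∈ S ∩ U) ∧ (∀ n, ‖f n‖ ≤ 1) ∧
      (∀ n, 1 - ε < (f n : C(K, ℝ)) (p n)) ∧ UnconditionallyBoundedBy f 2 := by
  obtain ⟨p, V, hp, hpV, hV⟩ := exists_seq_pairwise_disjoint_nhds_of_accPt hx hU
  obtain ⟨η, hη, hηsum⟩ := (countable_univ (α := ℕ)).exists_pos_forall_sum_le
    (show 0 < min ε (1 / 2) by positivity)
  have hηle (n : ℕ) : η n ≤ min ε (1 / 2) := by simpa using hηsum {n} (subset_univ _)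
  have hηsum_one (F : Finset ℕ) : ∑ i ∈ F, η i ≤ 1 :=
    (hηsum F (subset_univ _)).trans ((min_le_right _ _).trans one_half_lt_one.le)
  choose f hfM hf hfp hfV using fun n => hS (hp n).1 (V n) (hpV n) (η n) (hη n)
    ((hηle n).trans_lt ((min_le_right _ _).trans_lt one_half_lt_one))
  refine ⟨p, fun n => ⟨f n, hfM n⟩, hp, fun n => ?_, fun n => ?_, ?_⟩
  · refine (ContinuousMap.norm_le (f n) zero_le_one).2 fun y => ?_
    rw [Real.norm_of_nonneg (hf n y).1]
    exact (hf n y).2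
  · linarith [hfp n, hηle n, min_le_left ε (1 / 2)]
  · rw [← one_add_one_eq_two]
    exact unconditionallyBoundedBy_of_small_off_pairwise_disjoint hD hV (fun i => (hη i).le)
      hηsum_one hf fun i y hy => (hfV i y hy).le

theorem exists_peak_norm_apply_lt [T2Space K] (hD : IsBoundary M D) {S U : Set K}
    (hS : S ⊆ weakPeakSet M D) {x : K} (hx : AccPt x (𝓟 S)) (hU : U ∈ 𝓝 x)
    {E : Type v} [NormedAddCommGroup E] [NormedSpace ℝ E] [CompleteSpace E]
    (hE : ¬ ContainsCZero E) {ι : Type*} {s : Set ι} (hs : s.Finite) (R : ι → M →L[ℝ] E) {ε : ℝ}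
    (hε : 0 < ε) :
    ∃ p ∈ S ∩ U, ∃ f : M, ‖f‖ ≤ 1 ∧ 1 - ε < (f : C(K, ℝ)) p ∧ ∀ i ∈ s, ‖R i f‖ < ε := by
  obtain ⟨p, f, hp, hf, hfp, hbdd⟩ := exists_seq_peak_unconditionallyBoundedBy hD hS hx hU hε
  have hlarge : (⋃ i ∈ s, {n | ε ≤ ‖R i (f n)‖}).Finite :=
    hs.biUnion fun i _ => (hbdd.map (R i)).finite_setOf_le_norm hE hε
  obtain ⟨n, hn⟩ := hlarge.exists_notMem
  exact ⟨p n, hp n, f n, hf n, hfp n, fun i hi => lt_of_not_ge fun h => hn (mem_biUnion hi h)⟩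

variable {L : Type*} [TopologicalSpace L] [CompactSpace L]
  {E : Type v} [NormedAddCommGroup E] [NormedSpace ℝ E] {B : Set L} {k : ℕ}

/-- The `i` peak functions are added one by one while descending the derivatives: the next one is
chosen small under `T` at the finitely many points of `L` where the count is already exhausted. -/
theorem exists_lt_apply_norm_map_le [T2Space K] [CompleteSpace E] (hE : ¬ ContainsCZero E)
    (hD : IsBoundary M D) (T : M →L[ℝ] C(L, E)) {C : ℝ} (hTC : ∀ f, ‖T f‖ ≤ C * ‖f‖)
    (hC : 0 ≤ C) (hB : IsClosed B) (hT : ∀ y ∈ cbDerivative B (k : Ordinal), ∀ f, T f y = 0)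
    (i j : ℕ) (hne : (cbDerivative (weakPeakSet M D) ((i + j : ℕ) : Ordinal.{u})).Nonempty) {δ : ℝ}
    (hδ : 0 < δ) :
    ∃ x ∈ cbDerivative (weakPeakSet M D) (j : Ordinal.{u}), ∃ f : M, i - δ < (f : C(K, ℝ)) x ∧
      ∃ N, IsCorankCount B k N ∧ ∀ y, ‖T f y‖ ≤ N y * C + δ := by
  induction i generalizing j δ with
  | zero =>
    obtain ⟨x, hx⟩ := hne
    exact ⟨x, by simpa using hx, 0, by simpa using hδ, 0, .zero B k, fun _ => by simpa using hδ.le⟩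
  | succ i ih =>
    rw [Nat.succ_add_eq_add_succ] at hne
    obtain ⟨x, hx, g, hgx, N, hN, hgN⟩ := ih (j + 1) hne (half_pos hδ)
    have hU : {z | i - δ / 2 < (g : C(K, ℝ)) z} ∈ 𝓝 x :=
      (isOpen_lt continuous_const (g : C(K, ℝ)).continuous).mem_nhds hgx
    obtain ⟨p, ⟨hpj, hpU⟩, f, hf, hfp, hfT⟩ := exists_peak_norm_apply_lt hD
      (cbDerivative_subset _ _) (mem_cbDerivative_natCast_succ.1 hx).2 hU hE
      (hN.finite_setOf_le_add hB) (fun y => (ContinuousMap.evalCLM ℝ y).comp T) (half_pos hδ)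
    let Z : Set L := {y | δ / 2 ≤ ‖T f y‖}
    have hZ : IsClosed Z := isClosed_le continuous_const (T f).continuous.norm
    have hZN : ∀ r ≤ k, ∀ y ∈ cbDerivative B (r : Ordinal), k ≤ N y + r → y ∉ Z := by
      intro r hr y hy hk
      suffices hlt : ‖T f y‖ < δ / 2 from not_le.2 hlt
      rcases hr.lt_or_eq with hr | rfl
      · exact hfT y ⟨r, hr, hy, hk⟩
      · simpa [hT y hy f] using hδ
    have hfZ (y : L) : ‖T f y‖ ≤ (Z.indicator (fun _ => 1) y : ℕ) * C + δ / 2 := by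
      by_cases hy : y ∈ Z
      · rw [indicator_of_mem hy, Nat.cast_one]
        have hTf : ‖T f‖ ≤ C * 1 := (hTC f).trans (by gcongr)
        linarith [(T f).norm_coe_le_norm y]
      · rw [indicator_of_notMem hy, Nat.cast_zero, zero_mul, zero_add]
        exact (not_le.1 hy).le
    refine ⟨p, hpj, g + f, ?_, _, hN.add_indicator hZ hZN, fun y => ?_⟩
    · have hpU : i - δ / 2 < (g : C(K, ℝ)) p := hpU
      push_cast
      rw [Pi.add_apply]
      linarith
    · rw [map_add, ContinuousMap.add_apply]
      refine (norm_add_le _ _).trans ((add_le_add (hgN y) (hfZ y)).trans_eq ?_)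
      rw [Nat.cast_add]
      ring

theorem cbDerivative_weakPeakSet_eq_empty [T2Space K] [CompleteSpace E] (hE : ¬ ContainsCZero E)
    (hD : IsBoundary M D) {H : Submodule ℝ C(L, E)} (hB : IsClosed B) (hHB : IsBoundary H B)
    (hk : cbDerivative B (k : Ordinal) ∩ nonvanishingSet H = ∅) {T : M →L[ℝ] H} {C c : ℝ}
    (hTC : ∀ f, ‖T f‖ ≤ C * ‖f‖) (hTc : ∀ f, ‖f‖ ≤ c * ‖T f‖) (hC : 0 ≤ C) (hc : 0 ≤ c) {n : ℕ}
    (hn : c * (k * C) < n) :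
    cbDerivative (weakPeakSet M D) (n : Ordinal.{u}) = ∅ := by
  by_contra hne
  have hTk : ∀ y ∈ cbDerivative B (k : Ordinal), ∀ f, H.subtypeL.comp T f y = 0 :=
    fun y hy f => by_contra fun hfy => hk.le ⟨hy, _, (T f).2, hfy⟩
  obtain ⟨δ, hδ, hδn⟩ : ∃ δ : ℝ, 0 < δ ∧ c * (k * C + δ) + δ = n :=
    ⟨(n - c * (k * C)) / (c + 1), div_pos (sub_pos.2 hn) (by positivity), by field_simp; ring⟩
  obtain ⟨x, -, f, hfx, N, hN, hfN⟩ := exists_lt_apply_norm_map_le hE hD (H.subtypeL.comp T) hTC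
    hC hB hTk n 0 (nonempty_iff_ne_empty.2 hne) hδ
  have hTf : ‖T f‖ ≤ k * C + δ :=
    isBoundary_iff.1 hHB _ (T f).2 _ (by positivity) fun y hy => by
      refine (hfN y).trans ?_
      gcongr
      exact hN.le hy
  have hf : n - δ < c * (k * C + δ) := calc
    n - δ < (f : C(K, ℝ)) x := hfx
    _ ≤ ‖f‖ := (le_abs_self _).trans ((f : C(K, ℝ)).norm_coe_le_norm x)
    _ ≤ c * ‖T f‖ := hTc f
    _ ≤ c * (k * C + δ) := by gcongr
  linarith

end WeakPeakSet

section Multipliers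

variable {K : Type u} [TopologicalSpace K] [CompactSpace K] {E : Type v} [NormedAddCommGroup E]
  [NormedSpace ℝ E]

theorem norm_tensorVec (f : C(K, ℝ)) (e : E) : ‖tensorVec f e‖ = ‖f‖ * ‖e‖ := by
  rw [ContinuousMap.norm_eq_iSup_norm, ContinuousMap.norm_eq_iSup_norm,
    Real.iSup_mul_of_nonneg (norm_nonneg e)]
  exact iSup_congr fun x => norm_smul (f x) e

/-- The set `A^E` of multipliers of `H` as a linear subspace of `C(K)`. -/
noncomputable def multiplierSubmodule (H : Submodule ℝ C(K, E)) : Submodule ℝ C(K, ℝ) where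
  carrier := scalarMultipliers H
  zero_mem' := ⟨zero_mem _, fun e => by
    convert zero_mem H
    exact ContinuousMap.ext fun _ => zero_smul ℝ e⟩
  add_mem' hf hg := ⟨add_mem hf.1 hg.1, fun e => by
    convert add_mem (hf.2 e) (hg.2 e)
    ext x
    exact add_smul _ _ e⟩
  smul_mem' c f hf := ⟨Submodule.smul_mem _ c hf.1, fun e => by
    convert H.smul_mem c (hf.2 e)
    ext x
    exact smul_assoc c (f x) e⟩

theorem multiplierSubmodule_le_scalarSpace (H : Submodule ℝ C(K, E)) :
    multiplierSubmodule H ≤ scalarSpace H :=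
  fun _ hf => hf.1

theorem weakPeakPoints_eq_weakPeakSet (H : Submodule ℝ C(K, E)) :
    weakPeakPoints H = weakPeakSet (multiplierSubmodule H) (choquetBoundary H) :=
  rfl

/-- The embedding `f ↦ f ⊗ e` of the multipliers of `H` into `H`, for a unit vector `e`. -/
noncomputable def tensorLinearIsometry (H : Submodule ℝ C(K, E)) {e : E} (he : ‖e‖ = 1) :
    multiplierSubmodule H →ₗᵢ[ℝ] H where
  toFun f := ⟨tensorVec f e, f.2.2 e⟩
  map_add' f g := Subtype.ext <| ContinuousMap.ext fun x =>
    add_smul ((f : C(K, ℝ)) x) ((g : C(K, ℝ)) x) e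
  map_smul' c f := Subtype.ext <| ContinuousMap.ext fun x => smul_assoc c ((f : C(K, ℝ)) x) e
  norm_map' f := by
    change ‖tensorVec (f : C(K, ℝ)) e‖ = ‖(f : C(K, ℝ))‖
    rw [norm_tensorVec, he, mul_one]

theorem scalarSpace_eq_bot [Subsingleton E] (H : Submodule ℝ C(K, E)) : scalarSpace H = ⊥ := by
  have hspan : Submodule.span ℝ {f | ∃ φ : StrongDual ℝ E, ∃ h ∈ H, f = dualComp φ h} = ⊥ := by
    refine Submodule.span_eq_bot.2 ?_
    rintro _ ⟨φ, h, -, rfl⟩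
    ext x
    exact (congrArg φ (Subsingleton.elim (h x) 0)).trans φ.map_zero
  rw [scalarSpace, hspan]
  exact isClosed_singleton.submodule_topologicalClosure_eq

theorem weakPeakPoints_eq_empty [Subsingleton E] (H : Submodule ℝ C(K, E)) :
    weakPeakPoints H = ∅ := by
  refine eq_empty_of_forall_notMem fun _ hx => ?_
  obtain ⟨f, hf, -, hfx, -⟩ := hx univ univ_mem (1 / 2) (by norm_num) (by norm_num)
  rw [show f = 0 by simpa [scalarSpace_eq_bot] using hf.1] at hfx
  norm_num at hfx

end Multipliers

theorem corollary1p4_general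
    {K₁ K₂ E₁ E₂ : Type*}
    [TopologicalSpace K₁] [CompactSpace K₁] [T2Space K₁]
    [TopologicalSpace K₂] [CompactSpace K₂]
    [NormedAddCommGroup E₁] [NormedSpace ℝ E₁]
    [NormedAddCommGroup E₂] [NormedSpace ℝ E₂] [CompleteSpace E₂]
    (H₁ : Submodule ℝ C(K₁, E₁)) (H₂ : Submodule ℝ C(K₂, E₂)) (hE₂ : ¬ ContainsCZero E₂)
    (B : Set K₂) (hBclosed : IsClosed B) (hB : IsBoundary H₂ B)
    (hemb : EmbedsIsomorphically H₁ H₂)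
    (hk : ∃ k : ℕ, cbDerivative B k ∩ nonvanishingSet H₂ = ∅) :
    HasFiniteHeight (weakPeakPoints H₁) := by
  obtain ⟨k, hk⟩ := hk
  rcases subsingleton_or_nontrivial E₁ with _ | _
  · exact hasFiniteHeight_of_cbDerivative_natCast_eq_empty (n := 0) <| by
      rw [weakPeakPoints_eq_empty, Nat.cast_zero, cbDerivative_zero]
  obtain ⟨e, he⟩ := exists_norm_eq E₁ zero_le_one
  obtain ⟨T, c, hTc⟩ := embedsIsomorphically_iff.1 hemb
  obtain ⟨C, hC, hTC⟩ := T.bound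
  let J := tensorLinearIsometry H₁ he
  obtain ⟨n, hn⟩ := exists_nat_gt (c * (k * C))
  refine hasFiniteHeight_of_cbDerivative_natCast_eq_empty (n := n) ?_
  rw [weakPeakPoints_eq_weakPeakSet]
  exact cbDerivative_weakPeakSet_eq_empty hE₂
    ((isBoundary_choquetBoundary H₁).anti (multiplierSubmodule_le_scalarSpace H₁)) hBclosed hB hk
    (T := T.comp J.toContinuousLinearMap)
    (fun f => (hTC _).trans_eq (by rw [← J.norm_map f]; rfl))
    (fun f => (J.norm_map f).symm.trans_le (ZeroHomClass.bound_of_antilipschitz T hTc _))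
    hC.le c.2 hn

theorem corollary1p4
    {K₁ K₂ E₁ E₂ : Type*}
    [TopologicalSpace K₁] [CompactSpace K₁] [T2Space K₁]
    [TopologicalSpace K₂] [CompactSpace K₂] [T2Space K₂]
    [NormedAddCommGroup E₁] [NormedSpace ℝ E₁] [CompleteSpace E₁]
    [NormedAddCommGroup E₂] [NormedSpace ℝ E₂] [CompleteSpace E₂]
    (H₁ : Submodule ℝ C(K₁, E₁)) (hH₁ : IsClosed (H₁ : Set C(K₁, E₁)))
    (H₂ : Submodule ℝ C(K₂, E₂)) (hH₂ : IsClosed (H₂ : Set C(K₂, E₂)))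
    (hE₂ : ¬ ContainsCZero E₂)
    (B : Set K₂) (hBclosed : IsClosed B) (hB : IsBoundary H₂ B)
    (hemb : EmbedsIsomorphically H₁ H₂)
    (hk : ∃ k : ℕ, cbDerivative B k ∩ nonvanishingSet H₂ = ∅) :
    HasFiniteHeight (weakPeakPoints H₁) := by
  exact corollary1p4_general H₁ H₂ hE₂ B hBclosed hB hemb hk
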